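/- For $p\in\mathbb N$ and $\alpha\in\mathbb R$ let $$L_p^{(\alpha)}(x)=\sum_{j=0}^p(-1)^j\binom{\alpha+p}{p-j}\frac{x^j}{j!}$$ be the Laguerre polynomial of degree $p$ with parameter $\alpha$, where $\binom{\beta}{k}=\beta(\beta-1)\cdots(\beta-k+1)/k!$ is the generalized binomial coefficient. For $p\ge 1$ let $\xi_{p,1}^{(\alpha)},\dots,\xi_{p,p}^{(\alpha)}$ be its roots in $\mathbb C$, counted with multiplicity, and let $$m_p^{(\alpha)}=\frac1p\sum_{i=1}^p\delta_{\xi_{p,i}^{(\alpha)}/p}$$ be the empirical distribution of the roots divided by $p$. Let $(\alpha_p)$ be a sequence of real numbers with $\alpha_p/p\to c\in(-1,\infty)$ as $p\to\infty$. If $c<0$, assume in addition that $\alpha_p\in\{-p+1,\dots,-1\}$ for all sufficiently large $p$. Then $m_p^{(\alpha_p)}$ converges weakly, as $p\to\infty$, to the Marchenko–Pastur distribution $\mu_c$, the probability measure on $\mathbb R$ (regarded as a measure on $\mathbb C$ carried by $\mathbb R$) given by $$\mu_c=\begin{cases}-c\,\delta_0+\nu_c,&-1<c<0,\\ \nu_c,&c\ge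 0,\end{cases}$$ where $\nu_c$ has the density $$\frac{\sqrt{(x_+-x)(x-x_-)}}{2\pi x}\,\mathbf 1_{[x_-,x_+]}(x),\qquad x_\pm=\left(\sqrt{c+1}\pm1\right)^2 ,$$ with respect to Lebesgue measure on $\mathbb R$. -/

import Mathlib

open Filter Topology MeasureTheory Polynomial
open scoped ENNReal Nat

namespace LaguerreMP

noncomputable section

/-- The Laguerre polynomial `∑ j ≤ p, (-1)^j * binom(α + p, p - j) * x^j / j!` of degree `p` with real
parameter `α`; `Ring.choose` is the generalized binomial coefficient. -/
def laguerre (p : ℕ) (α : ℝ) : ℝ[X] :=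
  ∑ j ∈ Finset.range (p + 1),
    C ((-1) ^ j * Ring.choose (α + (p : ℝ)) (p - j) / (j ! : ℝ)) * X ^ j

/-- The complex roots of the Laguerre polynomial, counted with multiplicity. -/
def laguerreRoots (p : ℕ) (α : ℝ) : Multiset ℂ :=
  (laguerre p α).aroots ℂ

/-- The empirical distribution of the roots `ξ` divided by `p`, i.e. `p⁻¹ ∑ δ_(ξ / p)`. It is carried
by the complex plane, since the roots need not be real for a general real parameter. -/
def empirical (p : ℕ) (α : ℝ) : Measure ℂ :=
  (p : ℝ≥0∞)⁻¹ • ((laguerreRoots p α).map fun ξ => Measure.dirac (ξ / (p : ℂ))).sum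

/-- Left edge `(√(c + 1) - 1)^2`. -/
def xMinus (c : ℝ) : ℝ := (√(c + 1) - 1) ^ 2

/-- Right edge `(√(c + 1) + 1)^2`. -/
def xPlus (c : ℝ) : ℝ := (√(c + 1) + 1) ^ 2

/-- The density of the absolutely continuous part. -/
def density (c x : ℝ) : ℝ :=
  (Set.Icc (xMinus c) (xPlus c)).indicator
    (fun y => √((xPlus c - y) * (y - xMinus c)) / (2 * Real.pi * y)) x

/-- The absolutely continuous part. -/
def nu (c : ℝ) : Measure ℝ :=
  volume.withDensity fun x => ENNReal.ofReal (density c x)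

open Classical in
/-- The Marchenko–Pastur distribution, with an atom of mass `-c` at `0` if `c < 0`. -/
def marchenkoPastur (c : ℝ) : Measure ℝ :=
  if c < 0 then ENNReal.ofReal (-c) • Measure.dirac 0 + nu c else nu c

end

end LaguerreMP

/-!
Write `ξ` for the roots of `L_p^(α)`. The empirical means of a polynomial are combinations of the
normalized power sums `p^(-k-1) ∑ ξ^k`, so weak convergence comes down to three facts.

* The power sums converge to the moments of `μ_c`. Laguerre's differential equation is a Riccati
  equation for the logarithmic derivative, and hence a quadratic recurrence for the power sums
  (`powerSum_succ`), whose normalized form passes to the limit (`powerSum_tendsto`). The limits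
  `mpMoment c k` have an algebraic generating function of degree two, which gives them a linear
  recurrence (`mpMoment_add_two`); the integrals of `x^k` against the density satisfy the same
  linear recurrence by integration by parts (`edgeMoment_add_two`), and the two initial values are
  computed from explicit primitives.
* The rescaled roots stay in a fixed disc. When `|z| > 4 (p + 1 + |α|)`, the three-term recurrence
  makes `|L_n(z)|` grow so fast, up to the factor `1 / (n + 1)`, that it cannot vanish for `n ≤ p`
  (`laguerreRoots_norm_le`).
* Only `o(p)` roots are non-real. Rodrigues' formula builds `L_p^(α)` from a constant by repeatedly
  differentiating `x^β e^(-x) L`, and Rolle's theorem yields a new positive root at each step with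
  `β > 0`; this leaves at most `max 0 (-α)` non-real roots (`nonrealCount_le`). If `α = -m` with
  `m < p`, the missing `m` roots all sit at `0` (`nonrealCount_neg_natCast`). For `c = 0` the roots
  may well be non-real, but there are only `o(p)` of them.

A continuous function on the disc can then be replaced by a polynomial that is close to it on the
real axis: the real roots contribute a small error, and the non-real roots a bounded error each
(`tendsto_integral_empirical`).
-/

namespace LaguerreMP

/-! ### Generalized binomial coefficients and the coefficients of Laguerre polynomials -/

lemma succ_mul_choose_succ (r : ℝ) (k : ℕ) :
    ((k : ℝ) + 1) * Ring.choose r (k + 1) = (r - k) * Ring.choose r k := by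
  have h1 := Ring.descPochhammer_eq_factorial_smul_choose r k
  have h2 := Ring.descPochhammer_eq_factorial_smul_choose r (k + 1)
  rw [descPochhammer_succ_right, smeval_mul, h1] at h2
  simp only [smeval_sub, smeval_X, pow_one, smeval_natCast, pow_zero, nsmul_eq_mul, mul_one,
    Nat.factorial_succ, Nat.cast_mul, Nat.cast_add, Nat.cast_one] at h2
  have hk : (k ! : ℝ) ≠ 0 := by positivity
  apply mul_left_cancel₀ hk
  linarith

lemma choose_add_one_succ (r : ℝ) (k : ℕ) :
    ((k : ℝ) + 1) * Ring.choose (r + 1) (k + 1) = (r + 1) * Ring.choose r k := by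
  rw [Ring.choose_succ_succ, mul_add, succ_mul_choose_succ]
  ring

lemma coeff_laguerre (p : ℕ) (α : ℝ) (j : ℕ) : (laguerre p α).coeff j =
    if j ≤ p then (-1) ^ j * Ring.choose (α + (p : ℝ)) (p - j) / (j ! : ℝ) else 0 := by
  simp [laguerre, finsetSum_coeff, coeff_C_mul, coeff_X_pow]

lemma coeff_laguerre_of_add (k : ℕ) (α : ℝ) (j : ℕ) : (laguerre (j + k) α).coeff j =
    (-1) ^ j * Ring.choose (α + (j : ℝ) + k) k / (j ! : ℝ) := by
  rw [coeff_laguerre, if_pos (by lia), Nat.add_sub_cancel_left]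
  push_cast
  rw [add_assoc]

lemma coeff_laguerre_of_lt {p j : ℕ} (α : ℝ) (h : p < j) : (laguerre p α).coeff j = 0 := by
  rw [coeff_laguerre, if_neg (by lia)]

lemma coeff_laguerre_self (p : ℕ) (α : ℝ) :
    (laguerre p α).coeff p = (-1) ^ p / (p ! : ℝ) := by
  simp [coeff_laguerre]

lemma laguerre_zero (α : ℝ) : laguerre 0 α = 1 := by
  simp [laguerre]

lemma natDegree_laguerre (p : ℕ) (α : ℝ) : (laguerre p α).natDegree = p := by
  refine natDegree_eq_of_le_of_coeff_ne_zero (natDegree_le_iff_coeff_eq_zero.2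
    fun j hj => coeff_laguerre_of_lt α hj) ?_
  rw [coeff_laguerre_self]
  positivity

lemma laguerre_ne_zero (p : ℕ) (α : ℝ) : laguerre p α ≠ 0 := by
  intro h
  have := coeff_laguerre_self p α
  rw [h, coeff_zero] at this
  have h2 : (-1 : ℝ) ^ p / (p ! : ℝ) ≠ 0 := by positivity
  exact h2 this.symm

/-! ### Contiguity relations -/

/-- Pascal's rule. -/
lemma laguerre_add_one_param (n : ℕ) (α : ℝ) :
    laguerre (n + 1) (α + 1) = laguerre (n + 1) α + laguerre n (α + 1) := by
  ext j
  rw [coeff_add]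
  rcases lt_trichotomy j (n + 1) with h | rfl | h
  · obtain ⟨k, rfl⟩ := Nat.exists_eq_add_of_le (Nat.lt_succ_iff.1 h)
    rw [add_assoc j k 1, coeff_laguerre_of_add, coeff_laguerre_of_add, coeff_laguerre_of_add]
    push_cast
    rw [show α + 1 + (j : ℝ) + (k + 1) = (α + 1 + j + k) + 1 by ring, Ring.choose_succ_succ,
      show α + (j : ℝ) + (k + 1) = α + 1 + j + k by ring]
    ring
  · rw [coeff_laguerre_self, coeff_laguerre_self, coeff_laguerre_of_lt _ (by lia), add_zero]
  · simp [coeff_laguerre_of_lt _ h, coeff_laguerre_of_lt _ (show n < j by lia)]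

lemma X_mul_laguerre_add_one_param (n : ℕ) (α : ℝ) :
    X * laguerre n (α + 1) =
      C ((n : ℝ) + α + 1) * laguerre n α - C ((n : ℝ) + 1) * laguerre (n + 1) α := by
  ext j
  rw [coeff_sub, coeff_C_mul, coeff_C_mul]
  rcases lt_trichotomy j (n + 1) with h | rfl | h
  · obtain ⟨k, rfl⟩ := Nat.exists_eq_add_of_le (Nat.lt_succ_iff.1 h)
    have key := choose_add_one_succ (α + j + k) k
    rw [add_assoc j k 1, coeff_laguerre_of_add, coeff_laguerre_of_add]
    cases j with
    | zero =>
      push_cast at key ⊢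
      simp only [coeff_X_mul_zero, ← add_assoc] at key ⊢
      simp only [add_zero] at *
      simp only [pow_zero, Nat.factorial_zero, Nat.cast_one, div_one, one_mul, zero_add]
      linarith
    | succ i =>
      rw [coeff_X_mul, show i + 1 + k = i + (k + 1) by ring, coeff_laguerre_of_add]
      push_cast [Nat.factorial_succ] at key ⊢
      rw [show α + 1 + (i : ℝ) + (k + 1) = α + (i + 1) + k + 1 by ring,
        show α + ((i : ℝ) + 1) + (k + 1) = α + (i + 1) + k + 1 by ring]
      have hi : (i ! : ℝ) ≠ 0 := by positivity
      have hi' : (i : ℝ) + 1 ≠ 0 := by positivity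
      field_simp
      rw [pow_succ]
      linear_combination (-(-1 : ℝ) ^ i) * key
  · rw [coeff_X_mul, coeff_laguerre_self, coeff_laguerre_self, coeff_laguerre_of_lt _ (by lia),
      Nat.factorial_succ]
    push_cast
    have hi : (n ! : ℝ) ≠ 0 := by positivity
    have hi' : (n : ℝ) + 1 ≠ 0 := by positivity
    field_simp
    ring
  · obtain ⟨i, rfl⟩ : ∃ i, j = i + 1 := ⟨j - 1, by lia⟩
    rw [coeff_X_mul, coeff_laguerre_of_lt _ h, coeff_laguerre_of_lt _ (show n < i + 1 by lia),
      coeff_laguerre_of_lt _ (show n < i by lia)]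
    simp

/-- The three-term recurrence in the degree. -/
lemma laguerre_add_two (n : ℕ) (α : ℝ) :
    C ((n : ℝ) + 2) * laguerre (n + 2) α =
      (C (2 * (n : ℝ) + 3 + α) - X) * laguerre (n + 1) α
        - C ((n : ℝ) + 1 + α) * laguerre n α := by
  have h1 := laguerre_add_one_param n α
  have h2 := X_mul_laguerre_add_one_param n α
  have h3 := X_mul_laguerre_add_one_param (n + 1) α
  push_cast at h3
  simp only [C_add, C_mul, C_1, map_natCast] at *
  simp only [show C (3 : ℝ) = 3 from rfl, show C (2 : ℝ) = 2 from rfl] at *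
  linear_combination h3 - h2 - X * h1

/-- The relation `(n + 1) L_{n+1}^(α) = x L' + (α + 1 - x) L` with `L = L_n^(α+1)`, which is
Rodrigues' formula for one differentiation. -/
lemma laguerre_succ_eq_derivative (n : ℕ) (α : ℝ) :
    C ((n : ℝ) + 1) * laguerre (n + 1) α =
      X * derivative (laguerre n (α + 1)) + (C (α + 1) - X) * laguerre n (α + 1) := by
  ext j
  rw [sub_mul, coeff_add, coeff_sub, coeff_C_mul, coeff_C_mul]
  have hd : (X * derivative (laguerre n (α + 1))).coeff j = j * (laguerre n (α + 1)).coeff j := by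
    cases j with
    | zero => simp
    | succ i => rw [coeff_X_mul, coeff_derivative]; push_cast; ring
  rw [hd]
  rcases lt_trichotomy j (n + 1) with h | rfl | h
  · obtain ⟨k, rfl⟩ := Nat.exists_eq_add_of_le (Nat.lt_succ_iff.1 h)
    have key := succ_mul_choose_succ (α + 1 + j + k) k
    rw [add_assoc j k 1, coeff_laguerre_of_add, coeff_laguerre_of_add]
    cases j with
    | zero =>
      push_cast at key ⊢
      simp only [coeff_X_mul_zero] at key ⊢
      simp only [add_zero] at *
      simp only [pow_zero, Nat.factorial_zero, Nat.cast_one, div_one, one_mul, zero_add]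
      rw [show α + ((k : ℝ) + 1) = α + 1 + k by ring]
      linarith
    | succ i =>
      rw [coeff_X_mul, show i + 1 + k = i + (k + 1) by ring, coeff_laguerre_of_add]
      push_cast [Nat.factorial_succ] at key ⊢
      rw [show α + 1 + (i : ℝ) + (k + 1) = α + 1 + (i + 1) + k by ring,
        show α + ((i : ℝ) + 1) + (k + 1) = α + 1 + (i + 1) + k by ring]
      have hi : (i ! : ℝ) ≠ 0 := by positivity
      have hi' : (i : ℝ) + 1 ≠ 0 := by positivity
      field_simp
      rw [pow_succ]
      linear_combination (-(-1 : ℝ) ^ i) * key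
  · rw [coeff_X_mul, coeff_laguerre_self, coeff_laguerre_self, coeff_laguerre_of_lt _ (by lia),
      Nat.factorial_succ]
    push_cast
    have hi : (n ! : ℝ) ≠ 0 := by positivity
    have hi' : (n : ℝ) + 1 ≠ 0 := by positivity
    field_simp
    ring
  · obtain ⟨i, rfl⟩ : ∃ i, j = i + 1 := ⟨j - 1, by lia⟩
    rw [coeff_X_mul, coeff_laguerre_of_lt _ h, coeff_laguerre_of_lt _ (show n < i + 1 by lia),
      coeff_laguerre_of_lt _ (show n < i by lia)]
    simp

/-! ### The roots are bounded by `4 (p + |α|)` -/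

/-- Outside the disc of radius `4 K` the three-term recurrence forces `K |L_n| ≤ (n + 1) |L_{n+1}|`
as long as its coefficients are at most `2 K` and `K`, so no zero occurs there. -/
lemma norm_aeval_laguerre_growth (α : ℝ) {K : ℝ} (hK : 0 < K) {z : ℂ} (hz : 4 * K < ‖z‖) (n : ℕ)
    (hn : (n : ℝ) + 1 + |α| ≤ K) :
    aeval z (laguerre n α) ≠ 0 ∧
      K * ‖aeval z (laguerre n α)‖ ≤ ((n : ℝ) + 1) * ‖aeval z (laguerre (n + 1) α)‖ := by
  induction n with
  | zero =>
    have h1 : aeval z (laguerre 1 α) = 1 + (α : ℂ) - z := by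
      have h := congrArg (aeval z) (X_mul_laguerre_add_one_param 0 α)
      simp [laguerre_zero] at h
      linear_combination h
    refine ⟨by simp [laguerre_zero], ?_⟩
    rw [h1]
    simp only [laguerre_zero, map_one, norm_one, mul_one, CharP.cast_eq_zero, zero_add, one_mul]
    have h2 : ‖z‖ ≤ ‖1 + (α : ℂ) - z‖ + (1 + |α|) := by
      calc ‖z‖ = ‖(1 + (α : ℂ)) - (1 + (α : ℂ) - z)‖ := by congr 1; ring
        _ ≤ ‖1 + (α : ℂ)‖ + ‖1 + (α : ℂ) - z‖ := norm_sub_le _ _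
        _ ≤ _ := by
          have := norm_add_le (1 : ℂ) (α : ℂ)
          simp only [norm_one, Complex.norm_real, Real.norm_eq_abs] at this
          linarith
    simp at hn
    linarith
  | succ n ih =>
    push_cast at hn
    obtain ⟨h0, h1⟩ := ih (by linarith)
    set A := aeval z (laguerre n α)
    set B := aeval z (laguerre (n + 1) α)
    set D := aeval z (laguerre (n + 2) α)
    have hA : 0 < ‖A‖ := norm_pos_iff.2 h0
    have hB : 0 < ‖B‖ := by
      by_contra hB
      have : ‖B‖ = 0 := le_antisymm (not_lt.1 hB) (norm_nonneg _)
      rw [this] at h1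
      nlinarith
    refine ⟨norm_pos_iff.1 hB, ?_⟩
    have hrec : ((n : ℂ) + 2) * D = ((2 * n + 3 + α : ℝ) - z) * B - ((n + 1 + α : ℝ) : ℂ) * A := by
      have h := congrArg (aeval z) (laguerre_add_two n α)
      simp only [map_mul, map_sub, aeval_C, aeval_X] at h
      simpa using h
    have e1 : z * B = ((2 * n + 3 + α : ℝ) : ℂ) * B - ((n + 1 + α : ℝ) : ℂ) * A
        - ((n : ℂ) + 2) * D := by rw [hrec]; ring
    have hnD : ‖((n : ℂ) + 2) * D‖ = ((n : ℝ) + 2) * ‖D‖ := by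
      rw [norm_mul]
      congr 1
      rw [show (n : ℂ) + 2 = ((n + 2 : ℕ) : ℂ) by push_cast; ring, Complex.norm_natCast]
      push_cast; ring
    have e2 : ‖z‖ * ‖B‖ ≤ |2 * (n : ℝ) + 3 + α| * ‖B‖ + |(n : ℝ) + 1 + α| * ‖A‖
        + ((n : ℝ) + 2) * ‖D‖ := by
      rw [← norm_mul, e1, ← hnD]
      refine (norm_sub_le _ _).trans (add_le_add_left ((norm_sub_le _ _).trans ?_) _)
      rw [norm_mul, norm_mul, Complex.norm_real, Complex.norm_real, Real.norm_eq_abs,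
        Real.norm_eq_abs]
    have b1 : |2 * (n : ℝ) + 3 + α| ≤ 2 * K := by
      have := abs_add_le (2 * (n : ℝ) + 3) α
      rw [abs_of_nonneg (by positivity : (0 : ℝ) ≤ 2 * n + 3)] at this
      have := abs_nonneg α
      linarith
    have b2 : |(n : ℝ) + 1 + α| ≤ K := by
      have := abs_add_le ((n : ℝ) + 1) α
      rw [abs_of_nonneg (by positivity : (0 : ℝ) ≤ n + 1)] at this
      linarith
    have hα := abs_nonneg α
    have c1 : |(n : ℝ) + 1 + α| * ‖A‖ ≤ K * ‖B‖ := by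
      have : ((n : ℝ) + 1) * ‖B‖ ≤ K * ‖B‖ := by gcongr; linarith
      have : |(n : ℝ) + 1 + α| * ‖A‖ ≤ K * ‖A‖ := by gcongr
      linarith
    have c2 : |2 * (n : ℝ) + 3 + α| * ‖B‖ ≤ 2 * K * ‖B‖ := by gcongr
    have c3 : 4 * K * ‖B‖ ≤ ‖z‖ * ‖B‖ := by gcongr
    push_cast
    rw [show (n : ℝ) + 1 + 1 = n + 2 by ring]
    linarith

lemma laguerreRoots_norm_le {p : ℕ} {α : ℝ} {z : ℂ} (hz : z ∈ laguerreRoots p α) :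
    ‖z‖ ≤ 4 * ((p : ℝ) + 1 + |α|) := by
  by_contra! h
  exact (norm_aeval_laguerre_growth α (by positivity) h p le_rfl).1
    (mem_aroots.1 hz).2

/-! ### Positive roots, by Rodrigues' formula and Rolle's theorem -/

/-- Rolle's theorem on `(a, ∞)`, reduced to `(0, 1)` by the substitution `x = a - log u`. -/
lemma exists_hasDerivAt_eq_zero_Ioi {f f' : ℝ → ℝ} {a : ℝ} (ha : Tendsto f (𝓝[>] a) (𝓝 0))
    (htop : Tendsto f atTop (𝓝 0)) (hf : ∀ x, a < x → HasDerivAt f (f' x) x) :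
    ∃ x, a < x ∧ f' x = 0 := by
  have hpos : ∀ u ∈ Set.Ioo (0 : ℝ) 1, a < a - Real.log u := fun u hu => by
    have := Real.log_neg hu.1 hu.2
    linarith
  have h0 : Tendsto (fun u : ℝ => f (a - Real.log u)) (𝓝[>] 0) (𝓝 0) := by
    refine htop.comp ?_
    simpa [sub_eq_add_neg] using tendsto_atTop_add_const_left _ a
      (tendsto_neg_atBot_atTop.comp Real.tendsto_log_nhdsGT_zero)
  have h1 : Tendsto (fun u : ℝ => f (a - Real.log u)) (𝓝[<] 1) (𝓝 0) := by
    refine ha.comp (tendsto_nhdsWithin_iff.2 ⟨?_, ?_⟩)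
    · have : ContinuousAt (fun u : ℝ => a - Real.log u) 1 :=
        continuousAt_const.sub (Real.continuousAt_log one_ne_zero)
      have h := this.tendsto
      simp only [Real.log_one, sub_zero] at h
      exact h.mono_left nhdsWithin_le_nhds
    · filter_upwards [Ioo_mem_nhdsLT (zero_lt_one (α := ℝ))] with u hu using hpos u hu
  obtain ⟨u, hu, h⟩ := exists_hasDerivAt_eq_zero' (f' := fun u => f' (a - Real.log u) * (-u⁻¹))
    zero_lt_one h0 h1 fun u hu =>
      (hf _ (hpos u hu)).comp u ((Real.hasDerivAt_log hu.1.ne').const_sub a)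
  refine ⟨_, hpos u hu, (mul_eq_zero.1 h).resolve_right ?_⟩
  exact neg_ne_zero.2 (inv_ne_zero hu.1.ne')

/-- A function on `(a, ∞)` that vanishes at both ends and at `k` inner points has `k + 1` critical
points. -/
lemma exists_finset_critical_of_tendsto {f f' : ℝ → ℝ} (htop : Tendsto f atTop (𝓝 0)) (k : ℕ) :
    ∀ {a : ℝ}, Tendsto f (𝓝[>] a) (𝓝 0) → (∀ x, a < x → HasDerivAt f (f' x) x) →
      ∀ s : Finset ℝ, s.card = k → (∀ x ∈ s, a < x ∧ f x = 0) →
        ∃ t : Finset ℝ, t.card = k + 1 ∧ ∀ x ∈ t, a < x ∧ f' x = 0 := by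
  induction k with
  | zero =>
    intro a ha hf s _ _
    obtain ⟨x, hx⟩ := exists_hasDerivAt_eq_zero_Ioi ha htop hf
    exact ⟨{x}, by simp, by simpa using hx⟩
  | succ k ih =>
    intro a ha hf s hs hz
    have hne : s.Nonempty := Finset.card_pos.1 (by lia)
    set b := s.min' hne
    have hb : b ∈ s := s.min'_mem hne
    obtain ⟨hab, hfb⟩ := hz b hb
    have hcont : Tendsto f (𝓝 b) (𝓝 0) := by simpa [hfb] using (hf b hab).continuousAt.tendsto
    obtain ⟨x, hx, hx0⟩ := exists_hasDerivAt_eq_zero' hab ha (hcont.mono_left nhdsWithin_le_nhds)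
      fun x hx => hf x hx.1
    obtain ⟨t, ht, htz⟩ := ih (hcont.mono_left nhdsWithin_le_nhds)
      (fun y hy => hf y (hab.trans hy)) (s.erase b) (by rw [Finset.card_erase_of_mem hb, hs]; rfl)
      fun y hy => ⟨s.min'_lt_of_mem_erase_min' hne hy, (hz y (Finset.mem_of_mem_erase hy)).2⟩
    refine ⟨insert x t, ?_, ?_⟩
    · rw [Finset.card_insert_of_notMem fun h => lt_asymm hx.2 (htz x h).1, ht]
    · intro y hy
      rcases Finset.mem_insert.1 hy with rfl | hy
      · exact ⟨hx.1, hx0⟩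
      · exact ⟨hab.trans (htz y hy).1, (htz y hy).2⟩

lemma tendsto_rpow_mul_exp_neg_mul_eval (β : ℝ) (Q : ℝ[X]) :
    Tendsto (fun x : ℝ => x ^ β * Real.exp (-x) * Q.eval x) atTop (𝓝 0) := by
  have h : Tendsto (fun x : ℝ => ∑ j ∈ Finset.range (Q.natDegree + 1),
      Q.coeff j * (x ^ (β + j) * Real.exp (-1 * x))) atTop (𝓝 0) := by
    have := tendsto_finsetSum (Finset.range (Q.natDegree + 1)) fun j _ =>
      (tendsto_rpow_mul_exp_neg_mul_atTop_nhds_zero (β + j) 1 one_pos).const_mul (Q.coeff j)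
    simpa using this
  refine h.congr' ?_
  filter_upwards [eventually_gt_atTop 0] with x hx
  rw [eval_eq_sum_range, Finset.mul_sum]
  refine Finset.sum_congr rfl fun j _ => ?_
  rw [Real.rpow_add hx, Real.rpow_natCast, neg_one_mul]
  ring

lemma hasDerivAt_rpow_mul_exp_neg_mul_laguerre (n : ℕ) (α : ℝ) {x : ℝ} (hx : 0 < x) :
    HasDerivAt (fun x : ℝ => x ^ (α + 1) * Real.exp (-x) * (laguerre n (α + 1)).eval x)
      (x ^ α * Real.exp (-x) * (((n : ℝ) + 1) * (laguerre (n + 1) α).eval x)) x := by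
  have h := congrArg (eval x) (laguerre_succ_eq_derivative n α)
  simp only [eval_mul, eval_add, eval_sub, eval_C, eval_X] at h
  have h1 := Real.hasDerivAt_rpow_const (x := x) (p := α + 1) (Or.inl hx.ne')
  have h2 : HasDerivAt (fun x : ℝ => Real.exp (-x)) (Real.exp (-x) * -1) x :=
    (hasDerivAt_neg x).exp
  refine ((h1.mul h2).mul ((laguerre n (α + 1)).hasDerivAt x)).congr_deriv ?_
  simp only [Pi.mul_apply]
  rw [h, add_sub_cancel_right, Real.rpow_add hx, Real.rpow_one]
  ring

/-- One Rodrigues step keeps the number of positive roots. If the new parameter exceeds `-1`, the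
differentiated function also vanishes at `0`, and a root is gained. -/
lemma exists_finset_roots_succ (n : ℕ) (α : ℝ) (s : Finset ℝ)
    (hs : ∀ x ∈ s, 0 < x ∧ (laguerre n (α + 1)).eval x = 0) :
    (∃ t : Finset ℝ, t.card = s.card ∧ ∀ x ∈ t, 0 < x ∧ (laguerre (n + 1) α).eval x = 0) ∧
    (0 < α + 1 → ∃ t : Finset ℝ, t.card = s.card + 1 ∧
      ∀ x ∈ t, 0 < x ∧ (laguerre (n + 1) α).eval x = 0) := by
  set f : ℝ → ℝ := fun x => x ^ (α + 1) * Real.exp (-x) * (laguerre n (α + 1)).eval x with hf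
  have htop : Tendsto f atTop (𝓝 0) := tendsto_rpow_mul_exp_neg_mul_eval _ _
  have hderiv := fun (x : ℝ) (hx : 0 < x) => hasDerivAt_rpow_mul_exp_neg_mul_laguerre n α hx
  have hz : ∀ x ∈ s, 0 < x ∧ f x = 0 := fun x hx => ⟨(hs x hx).1, by simp [hf, (hs x hx).2]⟩
  have hroot : ∀ {x : ℝ}, 0 < x →
      x ^ α * Real.exp (-x) * (((n : ℝ) + 1) * (laguerre (n + 1) α).eval x) = 0 →
      (laguerre (n + 1) α).eval x = 0 := fun {x} hx h => by
    have h1 : 0 < x ^ α * Real.exp (-x) := mul_pos (Real.rpow_pos_of_pos hx _) (Real.exp_pos _)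
    have h2 : (n : ℝ) + 1 ≠ 0 := by positivity
    exact (mul_eq_zero.1 ((mul_eq_zero.1 h).resolve_left h1.ne')).resolve_left h2
  constructor
  · rcases s.eq_empty_or_nonempty with rfl | hne
    · exact ⟨∅, rfl, by simp⟩
    set b := s.min' hne
    have hb : b ∈ s := s.min'_mem hne
    obtain ⟨hb0, hfb⟩ := hz b hb
    have hcont : Tendsto f (𝓝 b) (𝓝 0) := by
      rw [← hfb]
      exact (hderiv b hb0).continuousAt.tendsto
    obtain ⟨t, ht, htz⟩ := exists_finset_critical_of_tendsto htop (s.erase b).card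
      (hcont.mono_left nhdsWithin_le_nhds) (fun y hy => hderiv y (hb0.trans hy)) (s.erase b) rfl
      fun y hy => ⟨s.min'_lt_of_mem_erase_min' hne hy, (hz y (Finset.mem_of_mem_erase hy)).2⟩
    refine ⟨t, by rw [ht, Finset.card_erase_add_one hb], fun y hy => ?_⟩
    have hy0 := hb0.trans (htz y hy).1
    exact ⟨hy0, hroot hy0 (htz y hy).2⟩
  · intro hα
    have h0 : Tendsto f (𝓝[>] 0) (𝓝 0) := by
      have hc : ContinuousAt f 0 :=
        ((Real.continuousAt_rpow_const 0 (α + 1) (Or.inr hα.le)).mul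
          (Real.continuous_exp.comp continuous_neg).continuousAt).mul
          (laguerre n (α + 1)).continuous.continuousAt
      have := hc.tendsto
      simp only [hf, Real.zero_rpow hα.ne', zero_mul] at this
      exact this.mono_left nhdsWithin_le_nhds
    obtain ⟨t, ht, htz⟩ := exists_finset_critical_of_tendsto htop s.card h0 hderiv s rfl hz
    exact ⟨t, ht, fun y hy => ⟨(htz y hy).1, hroot (htz y hy).1 (htz y hy).2⟩⟩

/-- Starting from `L_0^(α+n)`, the `i`-th Rodrigues step lowers the parameter to `α + n - i`, and it
gains a root if this exceeds `-1`, that is if `i < α + n + 1`. -/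
lemma exists_finset_pos_roots (n : ℕ) : ∀ (α : ℝ) (k : ℕ), k ≤ n → (k : ℝ) < α + n + 1 →
    ∃ s : Finset ℝ, s.card = k ∧ ∀ x ∈ s, 0 < x ∧ (laguerre n α).eval x = 0 := by
  induction n with
  | zero => exact fun α k hk _ => ⟨∅, by simp; lia, by simp⟩
  | succ n ih =>
    intro α k hk hkα
    push_cast at hkα
    rcases Nat.le_succ_iff.1 hk with hk | rfl
    · obtain ⟨s, hs, hz⟩ := ih (α + 1) k hk (by linarith)
      simpa [hs] using (exists_finset_roots_succ n α s hz).1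
    · push_cast at hkα
      obtain ⟨s, hs, hz⟩ := ih (α + 1) n le_rfl (by linarith)
      simpa [hs] using (exists_finset_roots_succ n α s hz).2 (by linarith)

/-- The number of non-real roots, counted with multiplicity. -/
noncomputable def nonrealCount (p : ℕ) (α : ℝ) : ℕ :=
  (laguerreRoots p α).countP fun z => z.im ≠ 0

lemma card_laguerreRoots (p : ℕ) (α : ℝ) : (laguerreRoots p α).card = p := by
  rw [laguerreRoots, aroots_def, IsAlgClosed.card_roots_map_eq_natDegree_of_injective,
    natDegree_laguerre]
  exact (algebraMap ℝ ℂ).injective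

/-- The roots found by Rolle's theorem are distinct and positive, so they and the root `0` account
for as many real roots. -/
lemma nonrealCount_add_le (p : ℕ) (α : ℝ) (k : ℕ) (hk : k ≤ p) (hkα : (k : ℝ) < α + p + 1) :
    nonrealCount p α + k + (laguerreRoots p α).count 0 ≤ p := by
  obtain ⟨s, hs, hz⟩ := exists_finset_pos_roots p α k hk hkα
  have hinj : Function.Injective ((↑) : ℝ → ℂ) := Complex.ofReal_injective
  set R := laguerreRoots p α with hR
  have hle : s.val.map ((↑) : ℝ → ℂ) + Multiset.replicate (R.count 0) 0 ≤
      R.filter fun z => ¬ z.im ≠ 0 := by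
    rw [Multiset.le_iff_count]
    intro z
    rw [Multiset.count_add, Multiset.count_replicate]
    by_cases hz0 : z = 0
    · subst hz0
      have h1 : (s.val.map ((↑) : ℝ → ℂ)).count 0 = 0 := by
        rw [Multiset.count_eq_zero, Multiset.mem_map]
        rintro ⟨x, hx, h⟩
        exact (hz x hx).1.ne' (by exact_mod_cast h)
      rw [h1, if_pos rfl, zero_add, Multiset.count_filter_of_pos (by simp)]
    · rw [if_neg (Ne.symm hz0), add_zero]
      by_cases hmem : z ∈ s.val.map ((↑) : ℝ → ℂ)
      · refine (Multiset.nodup_iff_count_le_one.1 (s.nodup.map hinj) z).trans ?_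
        obtain ⟨x, hx, rfl⟩ := Multiset.mem_map.1 hmem
        rw [Multiset.one_le_count_iff_mem, Multiset.mem_filter]
        refine ⟨mem_aroots.2 ⟨laguerre_ne_zero p α, ?_⟩, by simp⟩
        rw [show (x : ℂ) = algebraMap ℝ ℂ x from rfl, aeval_algebraMap_apply]
        simp [(hz x hx).2]
      · rw [Multiset.count_eq_zero_of_notMem hmem]
        exact Nat.zero_le _
  have hcard := Multiset.card_le_card hle
  have htot := R.card_eq_countP_add_countP fun z => z.im ≠ 0
  rw [hR, card_laguerreRoots, ← hR] at htot
  rw [Multiset.card_add, Multiset.card_map, Multiset.card_replicate,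
    ← Multiset.countP_eq_card_filter, Finset.card_val, hs] at hcard
  unfold nonrealCount
  lia

lemma nonrealCount_le (p : ℕ) (α : ℝ) : (nonrealCount p α : ℝ) ≤ max 0 (-α) := by
  rcases le_or_gt 0 α with h0 | h0
  · have h1 := nonrealCount_add_le p α p le_rfl (by linarith)
    have h2 : nonrealCount p α = 0 := by lia
    simp [h2]
  refine le_trans ?_ (le_max_right _ _)
  rcases lt_or_ge (α + p) 0 with h | h
  · have h1 : nonrealCount p α ≤ p :=
      (Multiset.countP_le_card _ _).trans (card_laguerreRoots p α).le
    have h2 : (nonrealCount p α : ℝ) ≤ p := by exact_mod_cast h1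
    linarith
  · have h1 := nonrealCount_add_le p α ⌈α + p⌉₊ (Nat.ceil_le.2 (by linarith))
      (Nat.ceil_lt_add_one h)
    have h2 : ((nonrealCount p α + ⌈α + p⌉₊ : ℕ) : ℝ) ≤ p := by exact_mod_cast (by lia)
    have h3 := Nat.le_ceil (α + p)
    push_cast at h2
    linarith

lemma laguerre_neg_count_zero {p m : ℕ} (hm : m < p) :
    m ≤ (laguerreRoots p (-(m : ℝ))).count 0 := by
  have hdvd : (X : ℝ[X]) ^ m ∣ laguerre p (-(m : ℝ)) := by
    rw [X_pow_dvd_iff]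
    intro j hj
    rw [coeff_laguerre, if_pos (by lia), show -(m : ℝ) + p = ((p - m : ℕ) : ℝ) by
      rw [Nat.cast_sub hm.le]; ring, Ring.choose_natCast, Nat.choose_eq_zero_of_lt (by lia)]
    simp
  rw [laguerreRoots, aroots_def, count_roots, le_rootMultiplicity_iff
    ((Polynomial.map_ne_zero_iff (algebraMap ℝ ℂ).injective).2 (laguerre_ne_zero _ _))]
  simpa using Polynomial.map_dvd (algebraMap ℝ ℂ) hdvd

lemma nonrealCount_neg_natCast {p m : ℕ} (hm : m < p) : nonrealCount p (-(m : ℝ)) = 0 := by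
  have h1 := nonrealCount_add_le p (-(m : ℝ)) (p - m) (Nat.sub_le _ _)
    (by rw [Nat.cast_sub hm.le]; linarith)
  have h2 := laguerre_neg_count_zero hm
  lia

/-! ### Power sums of the roots -/

/-- The power sum `∑ ξ ^ k` over the roots, with multiplicity. -/
noncomputable def powerSum (p : ℕ) (α : ℝ) (k : ℕ) : ℂ :=
  ((laguerreRoots p α).map fun ξ => ξ ^ k).sum

/-- Newton's identities for a multiset `s` as an identity of power series: if
`R = ∏ (1 - ξ X)` and `v` is the generating function of the power sums, then
`v R = |s| R - X R'`. -/
lemma powerSum_series_mul_prod (s : Multiset ℂ) :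
    PowerSeries.mk (fun k => (s.map fun ξ => ξ ^ k).sum) *
        (s.map fun ξ => 1 - PowerSeries.C ξ * PowerSeries.X).prod =
      (s.card : PowerSeries ℂ) * (s.map fun ξ => 1 - PowerSeries.C ξ * PowerSeries.X).prod -
        PowerSeries.X * PowerSeries.derivative ℂ
          (s.map fun ξ => 1 - PowerSeries.C ξ * PowerSeries.X).prod := by
  induction s using Multiset.induction_on with
  | empty =>
    have : PowerSeries.mk (fun _ : ℕ => (0 : ℂ)) = 0 := by ext; simp
    simp [this]
  | cons ξ s ih =>
    have h1 : PowerSeries.mk (fun k => ((ξ ::ₘ s).map fun ξ => ξ ^ k).sum) =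
        PowerSeries.mk (fun k => ξ ^ k) + PowerSeries.mk (fun k => (s.map fun ξ => ξ ^ k).sum) := by
      ext k; simp
    have h2 : PowerSeries.mk (fun k => ξ ^ k) * (1 - PowerSeries.C ξ * PowerSeries.X) = 1 := by
      ext k
      rw [mul_sub, mul_one, mul_left_comm, map_sub, PowerSeries.coeff_C_mul]
      cases k with
      | zero => simp
      | succ k => simp [PowerSeries.coeff_one, pow_succ, mul_comm]
    rw [h1]
    simp only [Multiset.map_cons, Multiset.prod_cons, Multiset.card_cons, Derivation.leibniz,
      smul_eq_mul, map_sub, PowerSeries.derivative_C, PowerSeries.derivative_X,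
      Derivation.map_one_eq_zero]
    push_cast
    generalize (s.map fun ξ => 1 - PowerSeries.C ξ * PowerSeries.X).prod = P at *
    linear_combination P * h2 + (1 - PowerSeries.C ξ * PowerSeries.X) * ih

lemma reverse_X_sub_C (a : ℂ) : (X - C a : ℂ[X]).reverse = 1 - C a * X := by
  ext n
  rw [coeff_reverse, natDegree_X_sub_C]
  rcases n with _ | _ | n
  · simp [revAt_le]
  · simp [revAt_le, coeff_one]
  · rw [revAt_eq_self_of_lt (by lia)]
    simp [coeff_X, coeff_one]

lemma reverse_C_mul_prod (a : ℂ) (s : Multiset ℂ) :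
    (C a * (s.map fun ξ => X - C ξ).prod).reverse = C a * (s.map fun ξ => 1 - C ξ * X).prod := by
  rw [reverse_mul_of_domain, reverse_C]
  congr 1
  induction s using Multiset.induction_on with
  | empty => simpa using reverse_C (1 : ℂ)
  | cons ξ s ih =>
    rw [Multiset.map_cons, Multiset.prod_cons, reverse_mul_of_domain, ih, reverse_X_sub_C,
      Multiset.map_cons, Multiset.prod_cons]

/-- The reversed Laguerre polynomial `x ^ p L(1 / x)`, as a power series. -/
noncomputable def reversedSeries (p : ℕ) (α : ℝ) : PowerSeries ℂ :=
  PowerSeries.mk fun i => if i ≤ p then (((laguerre p α).coeff (p - i) : ℝ) : ℂ) else 0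

lemma reversedSeries_eq (p : ℕ) (α : ℝ) : ∃ a : ℂ, reversedSeries p α =
    PowerSeries.C a *
      ((laguerreRoots p α).map fun ξ => 1 - PowerSeries.C ξ * PowerSeries.X).prod := by
  set Q : ℂ[X] := (laguerre p α).map (algebraMap ℝ ℂ) with hQ
  have hdeg : Q.natDegree = p := by
    rw [hQ, natDegree_map, natDegree_laguerre]
  have h1 : reversedSeries p α = (Q.reverse : PowerSeries ℂ) := by
    ext i
    rw [reversedSeries, PowerSeries.coeff_mk, Polynomial.coeff_coe, coeff_reverse, hdeg]
    split_ifs with h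
    · rw [revAt_le h, hQ, coeff_map]; rfl
    · rw [revAt_eq_self_of_lt (by lia), coeff_eq_zero_of_natDegree_lt (by lia)]
  have h2 := (IsAlgClosed.splits Q).eq_prod_roots
  refine ⟨Q.leadingCoeff, ?_⟩
  rw [h1, h2, reverse_C_mul_prod, ← h2, Polynomial.coe_mul, Polynomial.coe_C]
  congr 1
  change _ = (Q.roots.map _).prod
  induction Q.roots using Multiset.induction_on with
  | empty => simp
  | cons ξ s ih => simp [ih]

lemma reversedSeries_ne_zero (p : ℕ) (α : ℝ) : reversedSeries p α ≠ 0 := by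
  intro h
  have := congrArg (PowerSeries.coeff 0) h
  rw [reversedSeries, PowerSeries.coeff_mk, if_pos (Nat.zero_le _), Nat.sub_zero, map_zero,
    coeff_laguerre_self] at this
  have h2 : (-1 : ℝ) ^ p / (p ! : ℝ) ≠ 0 := by positivity
  exact h2 (by exact_mod_cast this)

/-- Laguerre's differential equation, coefficient by coefficient. -/
lemma reversedSeries_coeff_succ (p : ℕ) (α : ℝ) (i : ℕ) :
    ((i : ℂ) + 1) * PowerSeries.coeff (i + 1) (reversedSeries p α) +
      (((p : ℂ) - i) ^ 2 + α * ((p : ℂ) - i)) * PowerSeries.coeff i (reversedSeries p α) = 0 := by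
  simp only [reversedSeries, PowerSeries.coeff_mk]
  rcases lt_trichotomy i p with h | rfl | h
  · obtain ⟨j, rfl⟩ := Nat.exists_eq_add_of_lt h
    rw [if_pos (by lia), if_pos (by lia), show i + j + 1 - (i + 1) = j by lia,
      show i + j + 1 - i = j + 1 by lia]
    have e1 := coeff_laguerre_of_add (i + 1) α j
    have e2 := coeff_laguerre_of_add i α (j + 1)
    rw [show j + (i + 1) = i + j + 1 by ring] at e1
    rw [show j + 1 + i = i + j + 1 by ring] at e2
    rw [show α + (j : ℝ) + ((i + 1 : ℕ) : ℝ) = α + j + (i + 1) by push_cast; ring] at e1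
    rw [show α + ((j + 1 : ℕ) : ℝ) + (i : ℝ) = α + j + (i + 1) by push_cast; ring] at e2
    rw [e1, e2]
    have key := succ_mul_choose_succ (α + j + (i + 1)) i
    push_cast [Nat.factorial_succ]
    have hj : (j ! : ℂ) ≠ 0 := by exact_mod_cast (Nat.factorial_pos j).ne'
    have hj' : (j : ℂ) + 1 ≠ 0 := by exact_mod_cast Nat.succ_ne_zero j
    have key' := congrArg (fun x : ℝ => (x : ℂ)) key
    push_cast at key'
    field_simp
    rw [pow_succ]
    linear_combination ((-1 : ℂ) ^ j) * ((j : ℂ) + 1) * key'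
  · simp
  · simp [show ¬ i + 1 ≤ p by lia, show ¬ i ≤ p by lia]

/-- Laguerre's differential equation `θ R + X ((p - θ)² + α (p - θ)) R = 0` for the reversed
polynomial, with `θ = X d/dX` and with `v R` in place of `(p - θ) R`. -/
lemma reversedSeries_ode (p : ℕ) (α : ℝ) {R v : PowerSeries ℂ} (hR : R = reversedSeries p α)
    (hv : v * R = (p : PowerSeries ℂ) * R - PowerSeries.X * PowerSeries.derivative ℂ R) :
    PowerSeries.X * PowerSeries.derivative ℂ R + PowerSeries.X * ((p : PowerSeries ℂ) * (v * R) -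
      PowerSeries.X * PowerSeries.derivative ℂ (v * R) + PowerSeries.C (α : ℂ) * (v * R)) = 0 := by
  have hcoef : ∀ (f : PowerSeries ℂ) (i : ℕ),
      PowerSeries.coeff i (PowerSeries.X * PowerSeries.derivative ℂ f) =
        i * PowerSeries.coeff i f := by
    intro f i
    cases i with
    | zero => simp
    | succ i =>
      rw [PowerSeries.coeff_succ_X_mul, PowerSeries.coeff_derivative]
      push_cast; ring
  have hp : (p : PowerSeries ℂ) = PowerSeries.C (p : ℂ) := by simp
  ext i
  cases i with
  | zero => simp
  | succ i =>
    rw [map_add, hcoef, PowerSeries.coeff_succ_X_mul, map_add, map_sub, hcoef, hp,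
      PowerSeries.coeff_C_mul, PowerSeries.coeff_C_mul, hv, map_sub, hcoef, hp,
      PowerSeries.coeff_C_mul, map_zero, hR]
    have := reversedSeries_coeff_succ p α i
    push_cast
    linear_combination this

lemma powerSum_zero (p : ℕ) (α : ℝ) : powerSum p α 0 = p := by
  simp [powerSum, card_laguerreRoots]

/-- The Riccati equation for the logarithmic derivative of the Laguerre polynomial, read off as a
recurrence for the power sums of its roots. -/
lemma powerSum_succ (p : ℕ) (α : ℝ) (k : ℕ) :
    powerSum p α (k + 1) =
      ∑ ij ∈ Finset.HasAntidiagonal.antidiagonal k, powerSum p α ij.1 * powerSum p α ij.2 +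
        ((α : ℂ) - k) * powerSum p α k := by
  set v : PowerSeries ℂ := PowerSeries.mk (powerSum p α) with hvdef
  set R := reversedSeries p α with hR
  have hv : v * R = (p : PowerSeries ℂ) * R - PowerSeries.X * PowerSeries.derivative ℂ R := by
    obtain ⟨a, ha⟩ := reversedSeries_eq p α
    have h := powerSum_series_mul_prod (laguerreRoots p α)
    rw [card_laguerreRoots] at h
    rw [hR, ha, Derivation.leibniz, PowerSeries.derivative_C]
    simp only [smul_eq_mul, mul_zero, add_zero]
    have hvv : v = PowerSeries.mk fun k => ((laguerreRoots p α).map fun ξ => ξ ^ k).sum := rfl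
    rw [hvv]
    linear_combination PowerSeries.C a * h
  have hode := reversedSeries_ode p α hR hv
  rw [Derivation.leibniz] at hode
  simp only [smul_eq_mul] at hode
  -- Expanding `θ (v R)` by the product rule makes `R` a common factor.
  have hric : (p : PowerSeries ℂ) - v + PowerSeries.X * (v * v -
      PowerSeries.X * PowerSeries.derivative ℂ v + PowerSeries.C (α : ℂ) * v) = 0 := by
    refine (mul_eq_zero.1 ?_).resolve_right (reversedSeries_ne_zero p α)
    rw [← hR]
    linear_combination hode + (PowerSeries.X * v - 1) * hv
  have h := congrArg (PowerSeries.coeff (k + 1)) hric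
  rw [map_add, map_sub, PowerSeries.coeff_succ_X_mul, map_add, map_sub, PowerSeries.coeff_mul,
    PowerSeries.coeff_C_mul, map_zero] at h
  have hp : PowerSeries.coeff (k + 1) (p : PowerSeries ℂ) = 0 := by
    rw [show (p : PowerSeries ℂ) = PowerSeries.C (p : ℂ) by simp, PowerSeries.coeff_C]
    simp
  have hX : PowerSeries.coeff k (PowerSeries.X * PowerSeries.derivative ℂ v) =
      k * powerSum p α k := by
    cases k with
    | zero => simp
    | succ k =>
      rw [PowerSeries.coeff_succ_X_mul, PowerSeries.coeff_derivative, hvdef, PowerSeries.coeff_mk]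
      push_cast; ring
  rw [hp, hX] at h
  simp only [hvdef, PowerSeries.coeff_mk] at h
  linear_combination -h

/-! ### Limits of the normalized power sums -/

/-- The moments of the Marchenko-Pastur distribution, defined by the recurrence that the limits of
the normalized power sums satisfy. -/
noncomputable def mpMoment (c : ℝ) : ℕ → ℝ
  | 0 => 1
  | k + 1 => ∑ i : Fin (k + 1), mpMoment c i * mpMoment c (k - i) + c * mpMoment c k

lemma mpMoment_succ (c : ℝ) (k : ℕ) : mpMoment c (k + 1) =
    ∑ ij ∈ Finset.HasAntidiagonal.antidiagonal k, mpMoment c ij.1 * mpMoment c ij.2 +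
      c * mpMoment c k := by
  rw [mpMoment, Finset.Nat.sum_antidiagonal_eq_sum_range_succ_mk,
    Finset.sum_range fun i => mpMoment c i * mpMoment c (k - i)]

/-- The quadratic recurrence says that the generating function is algebraic of degree two. Its
discriminant satisfies a first-order linear differential equation, hence this linear recurrence. -/
lemma mpMoment_add_two (c : ℝ) (k : ℕ) :
    ((k : ℝ) + 3) * mpMoment c (k + 2) =
      (2 * k + 3) * (c + 2) * mpMoment c (k + 1) - k * c ^ 2 * mpMoment c k := by
  set v : PowerSeries ℝ := PowerSeries.mk (mpMoment c) with hv
  have hquad : 1 - v + PowerSeries.X * (v * v + PowerSeries.C c * v) = 0 := by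
    ext j
    cases j with
    | zero => simp [hv, mpMoment]
    | succ j =>
      rw [map_add, map_sub, PowerSeries.coeff_succ_X_mul, map_add, PowerSeries.coeff_mul,
        PowerSeries.coeff_C_mul, PowerSeries.coeff_one, if_neg (by lia)]
      simp only [hv, PowerSeries.coeff_mk, map_zero]
      rw [mpMoment_succ]
      ring
  -- `w ^ 2` is the discriminant of the quadratic equation `hquad`.
  set w : PowerSeries ℝ := 2 * (PowerSeries.X * v) + PowerSeries.C c * PowerSeries.X - 1 with hw
  set w' := PowerSeries.derivative ℝ w with hw'
  have hsq : w * w = (PowerSeries.C c * PowerSeries.X - 1) ^ 2 - 4 * PowerSeries.X := by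
    rw [hw]
    linear_combination 4 * PowerSeries.X * hquad
  have hder : 2 * (w * w') =
      2 * PowerSeries.C c * (PowerSeries.C c * PowerSeries.X - 1) - 4 := by
    have h := congrArg (PowerSeries.derivative ℝ) hsq
    have h4 : PowerSeries.derivative ℝ (4 : PowerSeries ℝ) = 0 :=
      PowerSeries.derivative_C (R := ℝ) (r := 4)
    simp only [Derivation.leibniz, Derivation.leibniz_pow, smul_eq_mul, map_sub,
      PowerSeries.derivative_C, PowerSeries.derivative_X, Derivation.map_one_eq_zero, h4] at h
    rw [← hw'] at h
    simp at h
    linear_combination h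
  have hlin : (w' - PowerSeries.X * (PowerSeries.C (2 * c + 4) * w') +
      PowerSeries.X * (PowerSeries.X * (PowerSeries.C (c ^ 2) * w'))) =
      PowerSeries.X * (PowerSeries.C (c ^ 2) * w) - PowerSeries.C (c + 2) * w := by
    have e1 : PowerSeries.C (2 * c + 4) = 2 * PowerSeries.C c + 4 := by
      rw [map_add, map_mul]; rfl
    have e2 : PowerSeries.C (c + 2) = PowerSeries.C c + 2 := by
      rw [map_add]; rfl
    rw [e1, e2, map_pow]
    have h2 : (2 : PowerSeries ℝ) ≠ 0 := fun h0 => by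
      have h1 := congrArg (PowerSeries.coeff 0) h0
      rw [show (2 : PowerSeries ℝ) = PowerSeries.C 2 from rfl, PowerSeries.coeff_C] at h1
      simp at h1
    apply mul_left_cancel₀ h2
    linear_combination w * hder - 2 * w' * hsq
  have hW : ∀ j : ℕ, PowerSeries.coeff (j + 1) w = 2 * mpMoment c j + if j = 0 then c else 0 := by
    intro j
    have h2 : (2 : PowerSeries ℝ) = PowerSeries.C 2 := rfl
    rw [hw, map_sub, map_add, h2, PowerSeries.coeff_C_mul, PowerSeries.coeff_C_mul,
      PowerSeries.coeff_succ_X_mul, PowerSeries.coeff_one, PowerSeries.coeff_X]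
    simp [hv]
  have h := congrArg (PowerSeries.coeff (k + 2)) hlin
  generalize ha : 2 * c + 4 = a at h
  generalize hb : c + 2 = b at h
  simp only [map_add, map_sub, PowerSeries.coeff_succ_X_mul, PowerSeries.coeff_C_mul, hw',
    PowerSeries.coeff_derivative, hW] at h
  subst ha hb
  push_cast at h
  rcases Nat.eq_zero_or_pos k with rfl | hk
  · simp at h ⊢
    linarith
  · simp [hk.ne'] at h
    linear_combination h / 2

lemma powerSum_tendsto {α : ℕ → ℝ} {c : ℝ}
    (hα : Tendsto (fun p : ℕ => α p / (p : ℝ)) atTop (𝓝 c)) (k : ℕ) :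
    Tendsto (fun p : ℕ => powerSum p (α p) k / (p : ℂ) ^ (k + 1)) atTop
      (𝓝 (mpMoment c k : ℂ)) := by
  induction k using Nat.strong_induction_on with
  | _ k ih =>
  have hp : ∀ᶠ p : ℕ in atTop, (p : ℂ) ≠ 0 := by
    filter_upwards [eventually_gt_atTop 0] with p hp
    exact_mod_cast hp.ne'
  cases k with
  | zero =>
    refine tendsto_const_nhds.congr' ?_
    filter_upwards [hp] with p hp
    simp [powerSum_zero, mpMoment, hp]
  | succ k =>
    have hα' : Tendsto (fun p : ℕ => ((α p : ℂ) - k) / (p : ℂ)) atTop (𝓝 (c : ℂ)) := by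
      have h1 : Tendsto (fun p : ℕ => (k : ℝ) / (p : ℝ)) atTop (𝓝 0) :=
        tendsto_const_div_atTop_nhds_zero_nat _
      have h2 := (Complex.continuous_ofReal.tendsto _).comp (hα.sub h1)
      rw [sub_zero] at h2
      refine h2.congr fun p => ?_
      simp [sub_div]
    have hsum : Tendsto (fun p : ℕ => ∑ ij ∈ Finset.HasAntidiagonal.antidiagonal k,
        (powerSum p (α p) ij.1 / (p : ℂ) ^ (ij.1 + 1)) *
          (powerSum p (α p) ij.2 / (p : ℂ) ^ (ij.2 + 1))) atTop
        (𝓝 (∑ ij ∈ Finset.HasAntidiagonal.antidiagonal k,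
          (mpMoment c ij.1 : ℂ) * mpMoment c ij.2)) := by
      refine tendsto_finsetSum _ fun ij hij => ?_
      have := Finset.HasAntidiagonal.mem_antidiagonal.1 hij
      exact (ih _ (by lia)).mul (ih _ (by lia))
    have hlim := hsum.add (hα'.mul (ih k (by lia)))
    rw [mpMoment_succ]
    push_cast
    refine hlim.congr' ?_
    filter_upwards [hp] with p hp
    rw [powerSum_succ, add_div, Finset.sum_div]
    congr 1
    · refine Finset.sum_congr rfl fun ij hij => ?_
      have := Finset.HasAntidiagonal.mem_antidiagonal.1 hij
      rw [div_mul_div_comm, ← pow_add]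
      congr 2
      lia
    · rw [div_mul_div_comm, ← pow_succ']

/-! ### Moments of the Marchenko-Pastur distribution -/

/-- The quadratic polynomial under the root in the density, with `b = √(c + 1)`. -/
noncomputable def edgeQuad (b x : ℝ) : ℝ := ((b + 1) ^ 2 - x) * (x - (b - 1) ^ 2)

lemma edgeQuad_pos {b x : ℝ} (hx : x ∈ Set.Ioo ((b - 1) ^ 2) ((b + 1) ^ 2)) : 0 < edgeQuad b x :=
  mul_pos (by linarith [hx.2]) (by linarith [hx.1])

lemma continuous_edgeQuad (b : ℝ) : Continuous (edgeQuad b) := by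
  unfold edgeQuad; fun_prop

lemma hasDerivAt_sqrt_edgeQuad {b x : ℝ} (hx : x ∈ Set.Ioo ((b - 1) ^ 2) ((b + 1) ^ 2)) :
    HasDerivAt (fun x => √(edgeQuad b x)) ((b ^ 2 + 1 - x) / √(edgeQuad b x)) x := by
  have h1 : HasDerivAt (edgeQuad b) (2 * (b ^ 2 + 1 - x)) x := by
    refine (((hasDerivAt_id x).const_sub ((b + 1) ^ 2)).mul
      ((hasDerivAt_id x).sub_const ((b - 1) ^ 2))).congr_deriv ?_
    simp only [id]
    ring
  refine (h1.sqrt (edgeQuad_pos hx).ne').congr_deriv ?_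
  rw [mul_div_mul_left _ _ two_ne_zero]

/-- The derivative of `arcsin u` when `1 - u ^ 2` is a known nonzero square. -/
lemma hasDerivAt_arcsin_of_sq {u : ℝ → ℝ} {u' r x : ℝ} (hu : HasDerivAt u u' x) (hr : 0 < r)
    (h : 1 - u x ^ 2 = r ^ 2) : HasDerivAt (fun x => Real.arcsin (u x)) (u' / r) x := by
  have h1 : u x ≠ -1 := fun h1 => by rw [h1] at h; nlinarith
  have h2 : u x ≠ 1 := fun h2 => by rw [h2] at h; nlinarith
  refine ((Real.hasDerivAt_arcsin h1 h2).comp x hu).congr_deriv ?_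
  rw [h, Real.sqrt_sq hr.le]
  ring

lemma hasDerivAt_arcsin_affine {b x : ℝ} (hb : 0 < b)
    (hx : x ∈ Set.Ioo ((b - 1) ^ 2) ((b + 1) ^ 2)) :
    HasDerivAt (fun x => Real.arcsin ((x - (b ^ 2 + 1)) / (2 * b))) (1 / √(edgeQuad b x)) x := by
  have hq := edgeQuad_pos hx
  have hs := Real.sqrt_pos.2 hq
  have hu : HasDerivAt (fun x : ℝ => (x - (b ^ 2 + 1)) / (2 * b)) (1 / (2 * b)) x :=
    ((hasDerivAt_id x).sub_const _).div_const _
  refine (hasDerivAt_arcsin_of_sq hu (r := √(edgeQuad b x) / (2 * b))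
    (by positivity) ?_).congr_deriv
    (by field_simp)
  rw [div_pow, div_pow, Real.sq_sqrt hq.le, edgeQuad]
  field_simp
  ring

lemma hasDerivAt_arcsin_moebius {b x : ℝ} (hb : 0 < b)
    (hx : x ∈ Set.Ioo ((b - 1) ^ 2) ((b + 1) ^ 2)) :
    HasDerivAt (fun x => |b ^ 2 - 1| *
        Real.arcsin (((b ^ 2 + 1) * x - (b ^ 2 - 1) ^ 2) / (2 * b * x)))
      ((b ^ 2 - 1) ^ 2 / (x * √(edgeQuad b x))) x := by
  -- For `b ^ 2 = 1` the argument of `arcsin` is constantly `1`, where `arcsin` has no derivative,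
  -- but the factor in front is `0`.
  by_cases hc : b ^ 2 - 1 = 0
  · simpa [hc] using hasDerivAt_const x (0 : ℝ)
  have hq := edgeQuad_pos hx
  have hs := Real.sqrt_pos.2 hq
  have hx0 : 0 < x := (sq_nonneg _).trans_lt hx.1
  have hc' : 0 < |b ^ 2 - 1| := abs_pos.2 hc
  have hu : HasDerivAt (fun x : ℝ => ((b ^ 2 + 1) * x - (b ^ 2 - 1) ^ 2) / (2 * b * x))
      ((b ^ 2 - 1) ^ 2 / (2 * b * x ^ 2)) x := by
    refine ((((hasDerivAt_id x).const_mul (b ^ 2 + 1)).sub_const ((b ^ 2 - 1) ^ 2)).div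
      ((hasDerivAt_id x).const_mul (2 * b)) (by simp only [id]; positivity)).congr_deriv ?_
    simp only [id]
    field_simp
    ring
  refine ((hasDerivAt_arcsin_of_sq hu (r := |b ^ 2 - 1| * √(edgeQuad b x) / (2 * b * x))
    (by positivity) ?_).const_mul |b ^ 2 - 1|).congr_deriv (by field_simp)
  rw [div_pow, div_pow, mul_pow |b ^ 2 - 1|, Real.sq_sqrt hq.le, sq_abs, edgeQuad]
  field_simp
  ring

/-- The total mass, from an explicit primitive. The integrand is singular at `0` if `b = 1`, but
it is nonnegative and its primitive is continuous up to the edges, hence it is integrable. -/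
lemma sqrt_edgeQuad_div_primitive {b : ℝ} (hb : 0 < b) :
    IntervalIntegrable (fun x => √(edgeQuad b x) / x) volume ((b - 1) ^ 2) ((b + 1) ^ 2) ∧
    ∫ x in (b - 1) ^ 2..(b + 1) ^ 2, √(edgeQuad b x) / x =
      Real.pi * (b ^ 2 + 1 - |b ^ 2 - 1|) := by
  have hle : (b - 1) ^ 2 ≤ (b + 1) ^ 2 := by nlinarith
  set F : ℝ → ℝ := fun x => √(edgeQuad b x) +
    (b ^ 2 + 1) * Real.arcsin ((x - (b ^ 2 + 1)) / (2 * b)) -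
    |b ^ 2 - 1| * Real.arcsin (((b ^ 2 + 1) * x - (b ^ 2 - 1) ^ 2) / (2 * b * x)) with hF
  have hcont : ContinuousOn F (Set.Icc ((b - 1) ^ 2) ((b + 1) ^ 2)) := by
    refine ContinuousOn.sub ?_ ?_
    · have := continuous_edgeQuad b
      have := Real.continuous_arcsin
      fun_prop
    -- For `b = 1` the argument of `arcsin` is `0 / 0` at the left edge, again with factor `0`.
    · by_cases hc : b ^ 2 - 1 = 0
      · simp only [hc, abs_zero, zero_mul]
        exact continuousOn_const
      · refine continuousOn_const.mul (Real.continuous_arcsin.comp_continuousOn ?_)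
        refine ContinuousOn.div (by fun_prop) (by fun_prop) fun x hx => ?_
        have h1 : 0 < (b - 1) ^ 2 := by
          refine sq_pos_of_ne_zero fun h => hc ?_
          linear_combination (b + 1) * h
        have := h1.trans_le hx.1
        positivity
  have hderiv : ∀ x ∈ Set.Ioo ((b - 1) ^ 2) ((b + 1) ^ 2),
      HasDerivAt F (√(edgeQuad b x) / x) x := by
    intro x hx
    have hq := edgeQuad_pos hx
    have hs := Real.sqrt_pos.2 hq
    have hx0 : 0 < x := (sq_nonneg _).trans_lt hx.1
    refine (((hasDerivAt_sqrt_edgeQuad hx).add ((hasDerivAt_arcsin_affine hb hx).const_mul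
      (b ^ 2 + 1))).sub (hasDerivAt_arcsin_moebius hb hx)).congr_deriv ?_
    have hsq := Real.sq_sqrt hq.le
    field_simp
    rw [hsq, edgeQuad]
    ring
  have hint : IntervalIntegrable (fun x => √(edgeQuad b x) / x) volume
      ((b - 1) ^ 2) ((b + 1) ^ 2) := by
    rw [intervalIntegrable_iff_integrableOn_Ioc_of_le hle]
    exact intervalIntegral.integrableOn_deriv_of_nonneg hcont hderiv fun x hx =>
      div_nonneg (Real.sqrt_nonneg _) ((sq_nonneg _).trans hx.1.le)
  refine ⟨hint, ?_⟩
  rw [intervalIntegral.integral_eq_sub_of_hasDerivAt_of_le hle hcont hderiv hint]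
  have e1 : ((b + 1) ^ 2 - (b ^ 2 + 1)) / (2 * b) = 1 := by field_simp; ring
  have e2 : ((b - 1) ^ 2 - (b ^ 2 + 1)) / (2 * b) = -1 := by field_simp; ring
  have e3 : ((b ^ 2 + 1) * (b + 1) ^ 2 - (b ^ 2 - 1) ^ 2) / (2 * b * (b + 1) ^ 2) = 1 := by
    field_simp; ring
  have e4 : |b ^ 2 - 1| * Real.arcsin (((b ^ 2 + 1) * (b - 1) ^ 2 - (b ^ 2 - 1) ^ 2) /
      (2 * b * (b - 1) ^ 2)) = |b ^ 2 - 1| * (-(Real.pi / 2)) := by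
    by_cases hc : b ^ 2 - 1 = 0
    · simp [hc]
    · have h1 : b - 1 ≠ 0 := fun h => hc (by linear_combination (b + 1) * h)
      rw [show ((b ^ 2 + 1) * (b - 1) ^ 2 - (b ^ 2 - 1) ^ 2) / (2 * b * (b - 1) ^ 2) = -1 by
        field_simp; ring, Real.arcsin_neg_one]
  simp only [hF]
  rw [e1, e2, e3, e4]
  simp only [edgeQuad, sub_self, zero_mul, mul_zero, Real.sqrt_zero, Real.arcsin_one,
    Real.arcsin_neg_one]
  ring

/-- `2π` times the `k`-th moment of the absolutely continuous part, with `b = √(c + 1)`. -/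
noncomputable def edgeMoment (b : ℝ) (k : ℕ) : ℝ :=
  ∫ x in (b - 1) ^ 2..(b + 1) ^ 2, x ^ k * (√(edgeQuad b x) / x)

lemma intervalIntegrable_edgeMoment {b : ℝ} (hb : 0 < b) (k : ℕ) :
    IntervalIntegrable (fun x => x ^ k * (√(edgeQuad b x) / x)) volume
      ((b - 1) ^ 2) ((b + 1) ^ 2) :=
  (sqrt_edgeQuad_div_primitive hb).1.continuousOn_mul (by fun_prop)

lemma edgeMoment_zero {b : ℝ} (hb : 0 < b) :
    edgeMoment b 0 = Real.pi * (b ^ 2 + 1 - |b ^ 2 - 1|) := by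
  simpa [edgeMoment] using (sqrt_edgeQuad_div_primitive hb).2

lemma edgeMoment_one {b : ℝ} (hb : 0 < b) : edgeMoment b 1 = 2 * Real.pi * b ^ 2 := by
  have hle : (b - 1) ^ 2 ≤ (b + 1) ^ 2 := by nlinarith
  set F : ℝ → ℝ := fun x => (x - (b ^ 2 + 1)) / 2 * √(edgeQuad b x) +
    2 * b ^ 2 * Real.arcsin ((x - (b ^ 2 + 1)) / (2 * b)) with hF
  have hcont : ContinuousOn F (Set.Icc ((b - 1) ^ 2) ((b + 1) ^ 2)) := by
    have := continuous_edgeQuad b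
    have := Real.continuous_arcsin
    fun_prop
  have hderiv : ∀ x ∈ Set.Ioo ((b - 1) ^ 2) ((b + 1) ^ 2),
      HasDerivAt F (x ^ 1 * (√(edgeQuad b x) / x)) x := by
    intro x hx
    have hq := edgeQuad_pos hx
    have hs := Real.sqrt_pos.2 hq
    have hx0 : 0 < x := (sq_nonneg _).trans_lt hx.1
    have hlin : HasDerivAt (fun x : ℝ => (x - (b ^ 2 + 1)) / 2) (1 / 2) x :=
      ((hasDerivAt_id x).sub_const _).div_const _
    refine ((hlin.mul (hasDerivAt_sqrt_edgeQuad hx)).add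
      ((hasDerivAt_arcsin_affine hb hx).const_mul (2 * b ^ 2))).congr_deriv ?_
    have hsq := Real.sq_sqrt hq.le
    field_simp
    rw [hsq, edgeQuad]
    ring
  rw [edgeMoment, intervalIntegral.integral_eq_sub_of_hasDerivAt_of_le hle hcont hderiv
    (intervalIntegrable_edgeMoment hb 1)]
  have e1 : ((b + 1) ^ 2 - (b ^ 2 + 1)) / (2 * b) = 1 := by field_simp; ring
  have e2 : ((b - 1) ^ 2 - (b ^ 2 + 1)) / (2 * b) = -1 := by field_simp; ring
  simp only [hF]
  rw [e1, e2]
  simp only [edgeQuad, sub_self, zero_mul, mul_zero, Real.sqrt_zero, Real.arcsin_one,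
    Real.arcsin_neg_one]
  ring

/-- Integration of the derivative of `x ^ k q ^ (3 / 2)`, which vanishes at both edges. -/
lemma edgeMoment_add_two {b : ℝ} (hb : 0 < b) (k : ℕ) :
    ((k : ℝ) + 3) * edgeMoment b (k + 2) =
      (2 * k + 3) * (b ^ 2 + 1) * edgeMoment b (k + 1) -
        k * (b ^ 2 - 1) ^ 2 * edgeMoment b k := by
  have hle : (b - 1) ^ 2 ≤ (b + 1) ^ 2 := by nlinarith
  have hint := fun j => intervalIntegrable_edgeMoment hb j
  set F : ℝ → ℝ := fun x => x ^ k * (√(edgeQuad b x)) ^ 3 with hF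
  have hcont : ContinuousOn F (Set.Icc ((b - 1) ^ 2) ((b + 1) ^ 2)) := by
    have := continuous_edgeQuad b
    fun_prop
  have hderiv : ∀ x ∈ Set.Ioo ((b - 1) ^ 2) ((b + 1) ^ 2), HasDerivAt F
      ((2 * k + 3) * (b ^ 2 + 1) * (x ^ (k + 1) * (√(edgeQuad b x) / x)) -
        k * (b ^ 2 - 1) ^ 2 * (x ^ k * (√(edgeQuad b x) / x)) -
        (k + 3) * (x ^ (k + 2) * (√(edgeQuad b x) / x))) x := by
    intro x hx
    have hq := edgeQuad_pos hx
    have hs := Real.sqrt_pos.2 hq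
    have hx0 : 0 < x := (sq_nonneg _).trans_lt hx.1
    refine ((hasDerivAt_pow k x).mul ((hasDerivAt_sqrt_edgeQuad hx).pow 3)).congr_deriv ?_
    have hsq := Real.sq_sqrt hq.le
    have hk : (k : ℝ) * x ^ (k - 1) = k * x ^ k / x := by
      cases k with
      | zero => simp
      | succ k => rw [Nat.add_sub_cancel, pow_succ]; field_simp
    rw [hk]
    have e3 : √(edgeQuad b x) ^ 3 = edgeQuad b x * √(edgeQuad b x) := by rw [pow_succ, hsq]
    simp only [Pi.pow_apply, Nat.add_one_sub_one]
    rw [e3]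
    have e4 : (b ^ 2 + 1 - x) / √(edgeQuad b x) * √(edgeQuad b x) ^ 2 =
      (b ^ 2 + 1 - x) * √(edgeQuad b x) := by field_simp
    have e5 : ∀ y : ℝ, y * √(edgeQuad b x) ^ 2 * ((b ^ 2 + 1 - x) / √(edgeQuad b x)) =
      y * ((b ^ 2 + 1 - x) * √(edgeQuad b x)) := fun y => by rw [← e4]; ring
    rw [e5]
    generalize √(edgeQuad b x) = r
    rw [edgeQuad]
    field_simp
    push_cast
    ring
  have h := intervalIntegral.integral_eq_sub_of_hasDerivAt_of_le hle hcont hderiv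
    ((((hint (k + 1)).const_mul _).sub ((hint k).const_mul _)).sub ((hint (k + 2)).const_mul _))
  rw [intervalIntegral.integral_sub
      (((hint (k + 1)).const_mul _).sub ((hint k).const_mul _)) ((hint (k + 2)).const_mul _),
    intervalIntegral.integral_sub ((hint (k + 1)).const_mul _) ((hint k).const_mul _),
    intervalIntegral.integral_const_mul, intervalIntegral.integral_const_mul,
    intervalIntegral.integral_const_mul] at h
  simp only [hF, edgeQuad, sub_self, zero_mul, mul_zero, Real.sqrt_zero] at h
  simp only [edgeMoment, edgeQuad]
  linarith

/-- Both sides satisfy the same linear recurrence. The zeroth moments do not enter, as their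
coefficient in the recurrence is `0`; they differ when `c < 0`. -/
lemma edgeMoment_succ_eq {c : ℝ} (hc : -1 < c) (k : ℕ) :
    edgeMoment √(c + 1) (k + 1) = 2 * Real.pi * mpMoment c (k + 1) := by
  have hb : 0 < √(c + 1) := Real.sqrt_pos.2 (by linarith)
  have hb2 : √(c + 1) ^ 2 = c + 1 := Real.sq_sqrt (by linarith)
  have h1 : edgeMoment √(c + 1) 1 = 2 * Real.pi * mpMoment c 1 := by
    rw [edgeMoment_one hb, hb2, mpMoment_succ]
    simp [mpMoment]
    ring
  have hrec : ∀ k : ℕ, (k : ℝ) * edgeMoment √(c + 1) k = 2 * Real.pi * (k * mpMoment c k) →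
      edgeMoment √(c + 1) (k + 1) = 2 * Real.pi * mpMoment c (k + 1) →
      edgeMoment √(c + 1) (k + 2) = 2 * Real.pi * mpMoment c (k + 2) := by
    intro k e1 e2
    have a := edgeMoment_add_two hb k
    have b := mpMoment_add_two c k
    rw [hb2] at a
    have h3 : (k : ℝ) + 3 ≠ 0 := by positivity
    apply mul_left_cancel₀ h3
    linear_combination a - 2 * Real.pi * b + (2 * (k : ℝ) + 3) * (c + 2) * e2 - c ^ 2 * e1
  induction k using Nat.twoStepInduction with
  | zero => exact h1
  | one => exact hrec 0 (by simp) h1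
  | more k ih1 ih2 => exact hrec (k + 1) (by rw [ih1]; ring) ih2

lemma density_eq (c x : ℝ) : density c x =
    (Set.Icc ((√(c + 1) - 1) ^ 2) ((√(c + 1) + 1) ^ 2)).indicator
      (fun y => (2 * Real.pi)⁻¹ * (√(edgeQuad √(c + 1) y) / y)) x := by
  unfold density xMinus xPlus edgeQuad
  congr 1
  ext y
  rw [← div_eq_inv_mul, div_div, mul_comm y]

lemma density_nonneg (c x : ℝ) : 0 ≤ density c x := by
  unfold density
  refine Set.indicator_nonneg (fun y hy => ?_) x
  have : 0 ≤ y := (sq_nonneg _).trans hy.1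
  positivity

lemma measurable_density (c : ℝ) : Measurable (density c) := by
  unfold density
  refine Measurable.indicator ?_ measurableSet_Icc
  fun_prop

lemma edges_le {c : ℝ} : (√(c + 1) - 1) ^ 2 ≤ (√(c + 1) + 1) ^ 2 := by
  nlinarith [Real.sqrt_nonneg (c + 1)]

lemma integrable_density {c : ℝ} (hc : -1 < c) : Integrable (density c) := by
  have hb : 0 < √(c + 1) := Real.sqrt_pos.2 (by linarith)
  rw [show density c = _ from funext (density_eq c), integrable_indicator_iff measurableSet_Icc,
    integrableOn_Icc_iff_integrableOn_Ioc, ← intervalIntegrable_iff_integrableOn_Ioc_of_le edges_le]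
  exact (sqrt_edgeQuad_div_primitive hb).1.const_mul _

lemma integral_nu (c : ℝ) (g : ℝ → ℝ) : ∫ x, g x ∂(nu c) =
    (2 * Real.pi)⁻¹ * ∫ x in (√(c + 1) - 1) ^ 2..(√(c + 1) + 1) ^ 2,
      g x * (√(edgeQuad √(c + 1) x) / x) := by
  rw [nu, integral_withDensity_eq_integral_toReal_smul (measurable_density c).ennreal_ofReal
    (Eventually.of_forall fun _ => ENNReal.ofReal_lt_top), intervalIntegral.integral_of_le edges_le,
    ← integral_Icc_eq_integral_Ioc, ← integral_const_mul, ← integral_indicator measurableSet_Icc]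
  refine integral_congr_ae (Eventually.of_forall fun x => ?_)
  simp only [smul_eq_mul]
  rw [ENNReal.toReal_ofReal (density_nonneg c x), density_eq c]
  by_cases hx : x ∈ Set.Icc ((√(c + 1) - 1) ^ 2) ((√(c + 1) + 1) ^ 2)
  · rw [Set.indicator_of_mem hx, Set.indicator_of_mem hx]; ring
  · rw [Set.indicator_of_notMem hx, Set.indicator_of_notMem hx, zero_mul]

lemma integral_pow_nu (c : ℝ) (k : ℕ) :
    ∫ x, x ^ k ∂(nu c) = (2 * Real.pi)⁻¹ * edgeMoment √(c + 1) k :=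
  integral_nu c _

lemma nu_univ {c : ℝ} (hc : -1 < c) : nu c Set.univ = ENNReal.ofReal ((c + 2 - |c|) / 2) := by
  have hb : 0 < √(c + 1) := Real.sqrt_pos.2 (by linarith)
  have hb2 : √(c + 1) ^ 2 = c + 1 := Real.sq_sqrt (by linarith)
  have hlint : nu c Set.univ = ∫⁻ x, ENNReal.ofReal (density c x) := by
    rw [nu, withDensity_apply _ MeasurableSet.univ, Measure.restrict_univ]
  rw [hlint, ← ofReal_integral_eq_lintegral_ofReal (integrable_density hc)
    (Eventually.of_forall (density_nonneg c))]
  congr 1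
  have h := integral_pow_nu c 0
  rw [nu, integral_withDensity_eq_integral_toReal_smul (measurable_density c).ennreal_ofReal
    (Eventually.of_forall fun _ => ENNReal.ofReal_lt_top), edgeMoment_zero hb, hb2] at h
  simp only [ENNReal.toReal_ofReal (density_nonneg c _), smul_eq_mul, pow_zero, mul_one] at h
  rw [h, add_sub_cancel_right]
  field_simp
  ring

lemma isProbabilityMeasure_marchenkoPastur {c : ℝ} (hc : -1 < c) :
    IsProbabilityMeasure (marchenkoPastur c) := by
  refine ⟨?_⟩
  unfold marchenkoPastur
  split_ifs with h
  · rw [Measure.add_apply, Measure.smul_apply, measure_univ, nu_univ hc, smul_eq_mul, mul_one,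
      ← ENNReal.ofReal_add (by linarith) (by rw [abs_of_neg h]; linarith), abs_of_neg h,
      ← ENNReal.ofReal_one]
    congr 1
    ring
  · rw [nu_univ hc, abs_of_nonneg (not_lt.1 h), ← ENNReal.ofReal_one]
    congr 1
    ring

lemma xPlus_le {c : ℝ} (hc : -1 < c) : xPlus c ≤ 4 * (2 + |c|) := by
  have h1 := Real.sq_sqrt (show 0 ≤ c + 1 by linarith)
  have h2 := le_abs_self c
  unfold xPlus
  nlinarith [sq_nonneg (√(c + 1) - 1), abs_nonneg c]

lemma ae_mem_Icc_nu {c : ℝ} (hc : -1 < c) :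
    ∀ᵐ x ∂(nu c), x ∈ Set.Icc (-(4 * (2 + |c|))) (4 * (2 + |c|)) := by
  rw [nu, ae_withDensity_iff (measurable_density c).ennreal_ofReal]
  refine Eventually.of_forall fun x hx => ?_
  have hmem : x ∈ Set.Icc (xMinus c) (xPlus c) := by
    by_contra h
    exact hx (by rw [density, Set.indicator_of_notMem h, ENNReal.ofReal_zero])
  have h0 : 0 ≤ xMinus c := sq_nonneg _
  have := xPlus_le hc
  have := abs_nonneg c
  exact ⟨by linarith [hmem.1], by linarith [hmem.2]⟩

lemma ae_mem_Icc_marchenkoPastur {c : ℝ} (hc : -1 < c) :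
    ∀ᵐ x ∂(marchenkoPastur c), x ∈ Set.Icc (-(4 * (2 + |c|))) (4 * (2 + |c|)) := by
  unfold marchenkoPastur
  split_ifs with h
  · rw [ae_add_measure_iff]
    refine ⟨Measure.ae_smul_measure ?_ _, ae_mem_Icc_nu hc⟩
    rw [ae_dirac_eq]
    have := abs_nonneg c
    exact ⟨by linarith, by linarith⟩
  · exact ae_mem_Icc_nu hc

lemma integrable_of_ae_mem_Icc {μ : Measure ℝ} [IsFiniteMeasure μ] {a b : ℝ}
    (hμ : ∀ᵐ x ∂μ, x ∈ Set.Icc a b) {g : ℝ → ℝ} (hg : Continuous g) : Integrable g μ := by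
  obtain ⟨C, hC⟩ := isCompact_Icc.exists_bound_of_continuousOn (s := Set.Icc a b) hg.continuousOn
  exact Integrable.of_bound hg.aestronglyMeasurable C (hμ.mono fun x hx => hC x hx)

lemma integral_pow_marchenkoPastur {c : ℝ} (hc : -1 < c) (k : ℕ) :
    ∫ x, x ^ k ∂(marchenkoPastur c) = mpMoment c k := by
  cases k with
  | zero =>
    have := isProbabilityMeasure_marchenkoPastur hc
    simp [mpMoment]
  | succ k =>
    have hpi := Real.pi_pos
    have hnu : ∫ x, x ^ (k + 1) ∂(nu c) = mpMoment c (k + 1) := by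
      rw [integral_pow_nu c, edgeMoment_succ_eq hc]
      field_simp
    unfold marchenkoPastur
    split_ifs with h
    · have hfin : IsFiniteMeasure (nu c) := ⟨by rw [nu_univ hc]; exact ENNReal.ofReal_lt_top⟩
      rw [integral_add_measure ((integrable_dirac (by simp)).smul_measure ENNReal.ofReal_ne_top)
        (integrable_of_ae_mem_Icc (ae_mem_Icc_nu hc) (by fun_prop)), integral_smul_measure,
        integral_dirac, hnu]
      simp
    · exact hnu

lemma integral_eval_marchenkoPastur {c : ℝ} (hc : -1 < c) (q : ℝ[X]) :
    ∫ x, q.eval x ∂(marchenkoPastur c) =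
      ∑ j ∈ Finset.range (q.natDegree + 1), q.coeff j * mpMoment c j := by
  have := isProbabilityMeasure_marchenkoPastur hc
  simp only [eval_eq_sum_range]
  rw [integral_finsetSum _ fun j _ =>
    integrable_of_ae_mem_Icc (ae_mem_Icc_marchenkoPastur hc) (by fun_prop)]
  simp only [integral_const_mul, integral_pow_marchenkoPastur hc]

/-! ### The empirical distribution -/

lemma integrable_and_integral_sum_dirac (s : Multiset ℂ) (a : ℂ) (f : ℂ → ℝ) :
    Integrable f (s.map fun ξ => Measure.dirac (ξ / a)).sum ∧
    ∫ z, f z ∂(s.map fun ξ => Measure.dirac (ξ / a)).sum = (s.map fun ξ => f (ξ / a)).sum := by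
  induction s using Multiset.induction_on with
  | empty => simp
  | cons ξ s ih =>
    have h : Integrable f (Measure.dirac (ξ / a)) := integrable_dirac (by simp)
    simp only [Multiset.map_cons, Multiset.sum_cons]
    exact ⟨h.add_measure ih.1, by rw [integral_add_measure h ih.1, ih.2, integral_dirac]⟩

lemma integral_empirical (p : ℕ) (α : ℝ) (f : ℂ → ℝ) : ∫ z, f z ∂(empirical p α) =
    (p : ℝ)⁻¹ * ((laguerreRoots p α).map fun ξ => f (ξ / p)).sum := by
  rw [empirical, integral_smul_measure, (integrable_and_integral_sum_dirac _ _ f).2]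
  simp

lemma isProbabilityMeasure_empirical {p : ℕ} (hp : 1 ≤ p) (α : ℝ) :
    IsProbabilityMeasure (empirical p α) := by
  have h : ∀ s : Multiset ℂ,
      (s.map fun ξ => Measure.dirac (ξ / (p : ℂ))).sum Set.univ = (s.card : ℝ≥0∞) := by
    intro s
    induction s using Multiset.induction_on with
    | empty => simp
    | cons ξ s ih => simp [ih, add_comm]
  refine ⟨?_⟩
  rw [empirical, Measure.smul_apply, h, card_laguerreRoots, smul_eq_mul]
  exact ENNReal.inv_mul_cancel (by exact_mod_cast (by lia)) (ENNReal.natCast_ne_top p)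

/-- Polynomial test functions: the means over the rescaled roots converge. -/
lemma tendsto_integral_empirical_aeval {α : ℕ → ℝ} {c : ℝ} (hc : -1 < c)
    (hα : Tendsto (fun p : ℕ => α p / (p : ℝ)) atTop (𝓝 c)) (q : ℝ[X]) :
    Tendsto (fun p : ℕ => ∫ z, (aeval z q : ℂ).re ∂(empirical p (α p))) atTop
      (𝓝 (∫ x, q.eval x ∂(marchenkoPastur c))) := by
  rw [integral_eval_marchenkoPastur hc]
  have h := tendsto_finsetSum (Finset.range (q.natDegree + 1)) fun j _ =>
    (powerSum_tendsto hα j).const_mul (q.coeff j : ℂ)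
  have h' := (Complex.continuous_re.tendsto _).comp h
  have e : (∑ j ∈ Finset.range (q.natDegree + 1), (q.coeff j : ℂ) * (mpMoment c j : ℂ)).re =
      ∑ j ∈ Finset.range (q.natDegree + 1), q.coeff j * mpMoment c j := by
    rw [← Complex.ofReal_re (∑ j ∈ Finset.range (q.natDegree + 1), q.coeff j * mpMoment c j)]
    push_cast
    rfl
  rw [e] at h'
  refine h'.congr fun p => ?_
  rw [integral_empirical]
  simp only [Function.comp_apply, powerSum]
  generalize laguerreRoots p (α p) = s
  induction s using Multiset.induction_on with
  | empty => simp
  | cons ξ s ih =>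
    simp only [Multiset.map_cons, Multiset.sum_cons, add_div, mul_add, Finset.sum_add_distrib,
      Complex.add_re, ih]
    congr 1
    rw [aeval_eq_sum_range, ← Complex.re_ofReal_mul, Finset.mul_sum]
    congr 1
    refine Finset.sum_congr rfl fun j _ => ?_
    rw [Complex.real_smul, div_pow, pow_succ]
    push_cast
    ring

/-- An error of `ε` at the real points of `s` and `ε + K` at the others. -/
lemma abs_sum_map_le (s : Multiset ℂ) (g : ℂ → ℝ) {ε K : ℝ}
    (h : ∀ z ∈ s, |g z| ≤ ε + if z.im ≠ 0 then K else 0) :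
    |(s.map g).sum| ≤ s.card * ε + K * s.countP fun z => z.im ≠ 0 := by
  induction s using Multiset.induction_on with
  | empty => simp
  | cons ξ s ih =>
    have h1 := h ξ (Multiset.mem_cons_self ξ s)
    have h2 := ih fun z hz => h z (Multiset.mem_cons_of_mem hz)
    rw [Multiset.map_cons, Multiset.sum_cons, Multiset.card_cons, Multiset.countP_cons]
    refine (abs_add_le _ _).trans ((add_le_add h1 h2).trans (le_of_eq ?_))
    split_ifs <;> push_cast <;> ring

lemma nonrealCount_div_tendsto {α : ℕ → ℝ} {c : ℝ}
    (hα : Tendsto (fun p : ℕ => α p / (p : ℝ)) atTop (𝓝 c))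
    (hneg : c < 0 → ∀ᶠ p : ℕ in atTop, ∃ m : ℕ, 1 ≤ m ∧ m < p ∧ α p = -(m : ℝ)) :
    Tendsto (fun p : ℕ => (nonrealCount p (α p) : ℝ) / p) atTop (𝓝 0) := by
  rcases lt_or_ge c 0 with hc | hc
  · refine tendsto_const_nhds.congr' ?_
    filter_upwards [hneg hc] with p hp
    obtain ⟨m, -, hm, h⟩ := hp
    simp [h, nonrealCount_neg_natCast hm]
  · have hlim : Tendsto (fun p : ℕ => max 0 (-(α p / (p : ℝ)))) atTop (𝓝 0) := by
      have := (tendsto_const_nhds (x := (0 : ℝ))).max hα.neg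
      rwa [max_eq_left (by linarith)] at this
    refine squeeze_zero (fun p => by positivity) (fun p => ?_) hlim
    have h := div_le_div_of_nonneg_right (nonrealCount_le p (α p)) (Nat.cast_nonneg (α := ℝ) p)
    rwa [← max_div_div_right (Nat.cast_nonneg _), zero_div, neg_div] at h

lemma eventually_laguerreRoots_norm_le {α : ℕ → ℝ} {c : ℝ}
    (hα : Tendsto (fun p : ℕ => α p / (p : ℝ)) atTop (𝓝 c)) :
    ∀ᶠ p : ℕ in atTop, ∀ ξ ∈ laguerreRoots p (α p), ‖ξ / (p : ℂ)‖ ≤ 4 * (2 + |c|) := by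
  have h1 : Tendsto (fun p : ℕ => 4 * (1 + 1 / (p : ℝ) + |α p / (p : ℝ)|)) atTop
      (𝓝 (4 * (1 + 0 + |c|))) :=
    ((tendsto_one_div_atTop_nhds_zero_nat.const_add 1).add hα.abs).const_mul 4
  filter_upwards [h1.eventually_le_const (show 4 * (1 + 0 + |c|) < 4 * (2 + |c|) by linarith),
    eventually_gt_atTop 0] with p hp hp0 ξ hξ
  have hp' : (0 : ℝ) < p := by exact_mod_cast hp0
  rw [norm_div, Complex.norm_natCast]
  refine le_trans ?_ hp
  rw [div_le_iff₀ hp', abs_div, abs_of_pos hp']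
  refine (laguerreRoots_norm_le hξ).trans (le_of_eq ?_)
  field_simp

/-- Weak convergence, tested against a bounded continuous function. On the real axis it is replaced
by a polynomial, and the few non-real roots contribute a vanishing amount. -/
lemma tendsto_integral_empirical {α : ℕ → ℝ} {c : ℝ} (hc : -1 < c)
    (hα : Tendsto (fun p : ℕ => α p / (p : ℝ)) atTop (𝓝 c))
    (hneg : c < 0 → ∀ᶠ p : ℕ in atTop, ∃ m : ℕ, 1 ≤ m ∧ m < p ∧ α p = -(m : ℝ))
    {f : ℂ → ℝ} (hf : Continuous f) :
    Tendsto (fun p : ℕ => ∫ z, f z ∂(empirical p (α p))) atTop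
      (𝓝 (∫ x : ℝ, f x ∂(marchenkoPastur c))) := by
  have := isProbabilityMeasure_marchenkoPastur hc
  set B := 4 * (2 + |c|)
  rw [Metric.tendsto_nhds]
  intro ε hε
  obtain ⟨q, hq⟩ := exists_polynomial_near_of_continuousOn (-B) B (fun x : ℝ => f x)
    (hf.comp Complex.continuous_ofReal).continuousOn (ε / 4) (by positivity)
  set Q : ℂ → ℝ := fun z => (aeval z q : ℂ).re with hQ
  have hQc : Continuous Q := Complex.continuous_re.comp (Polynomial.continuous_aeval q)
  have hQr : ∀ x : ℝ, Q x = q.eval x := fun x => by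
    rw [hQ]
    simp only
    rw [show (x : ℂ) = algebraMap ℝ ℂ x from rfl, aeval_algebraMap_apply]
    simp
  obtain ⟨K, hK⟩ := (isCompact_closedBall (0 : ℂ) B).exists_bound_of_continuousOn
    (hf.sub hQc).continuousOn
  have hlimit : |∫ x, q.eval x ∂(marchenkoPastur c) - ∫ x : ℝ, f x ∂(marchenkoPastur c)| ≤
      ε / 4 := by
    have hae := ae_mem_Icc_marchenkoPastur hc
    rw [← integral_sub (integrable_of_ae_mem_Icc hae q.continuous)
      (integrable_of_ae_mem_Icc (g := fun x : ℝ => f x) hae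
        (hf.comp Complex.continuous_ofReal)), ← Real.norm_eq_abs]
    refine (norm_integral_le_of_norm_le_const (hae.mono fun x hx => (hq x hx).le)).trans ?_
    simp
  have hpoly := (Metric.tendsto_nhds.1 (tendsto_integral_empirical_aeval hc hα q)) (ε / 4)
    (by positivity)
  have hnonreal : ∀ᶠ p : ℕ in atTop, K * ((nonrealCount p (α p) : ℝ) / p) < ε / 4 := by
    have h := (nonrealCount_div_tendsto hα hneg).const_mul K
    rw [mul_zero] at h
    exact h.eventually_lt_const (by positivity)
  filter_upwards [hpoly, hnonreal, eventually_laguerreRoots_norm_le hα, eventually_gt_atTop 0]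
    with p h1 h2 h3 hp0
  have hp' : (0 : ℝ) < p := by exact_mod_cast hp0
  have h4 : |∫ z, f z ∂(empirical p (α p)) - ∫ z, Q z ∂(empirical p (α p))| ≤
      ε / 4 + K * ((nonrealCount p (α p) : ℝ) / p) := by
    rw [integral_empirical, integral_empirical, ← mul_sub, ← Multiset.sum_map_sub, abs_mul,
      abs_of_pos (inv_pos.2 hp')]
    have h5 := abs_sum_map_le (laguerreRoots p (α p)) (fun ξ => f (ξ / p) - Q (ξ / p))
      (ε := ε / 4) (K := K) fun ξ hξ => by
        have hn := h3 ξ hξ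
        split_ifs with him
        · have := hK (ξ / p) (mem_closedBall_zero_iff.2 hn)
          rw [Real.norm_eq_abs] at this
          exact this.trans (by linarith)
        · rw [not_not] at him
          have hre : ξ / (p : ℂ) = ((ξ.re / p : ℝ) : ℂ) := by
            rw [Complex.ext_iff]
            simp [him]
          rw [hre] at hn ⊢
          rw [Complex.norm_real, Real.norm_eq_abs] at hn
          rw [hQr, abs_sub_comm, add_zero]
          exact (hq _ (abs_le.1 hn)).le
    rw [card_laguerreRoots] at h5
    refine (mul_le_mul_of_nonneg_left h5 (inv_pos.2 hp').le).trans (le_of_eq ?_)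
    unfold nonrealCount
    field_simp
  rw [Real.dist_eq] at h1 ⊢
  have t1 := abs_sub_le (∫ z, f z ∂(empirical p (α p))) (∫ z, Q z ∂(empirical p (α p)))
    (∫ x : ℝ, f x ∂(marchenkoPastur c))
  have t2 := abs_sub_le (∫ z, Q z ∂(empirical p (α p))) (∫ x, q.eval x ∂(marchenkoPastur c))
    (∫ x : ℝ, f x ∂(marchenkoPastur c))
  linarith

end LaguerreMP

theorem theorem1 (α : ℕ → ℝ) (c : ℝ) (hc : -1 < c)
    (hα : Tendsto (fun p : ℕ => α p / (p : ℝ)) atTop (𝓝 c))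
    (hneg : c < 0 → ∀ᶠ p : ℕ in atTop, ∃ m : ℕ, 1 ≤ m ∧ m < p ∧ α p = -(m : ℝ)) :
    ∃ (m : ℕ → ProbabilityMeasure ℂ) (μ : ProbabilityMeasure ℝ),
      (∀ p : ℕ, 1 ≤ p → (m p : Measure ℂ) = LaguerreMP.empirical p (α p)) ∧
      (μ : Measure ℝ) = LaguerreMP.marchenkoPastur c ∧
      Tendsto m atTop
        (𝓝 (μ.map (f := ((↑) : ℝ → ℂ)) Complex.measurable_ofReal.aemeasurable)) := by
  -- At `p = 0` the empirical distribution is the zero measure, so a point mass stands in for it.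
  have hex : ∀ p : ℕ, ∃ ν : ProbabilityMeasure ℂ,
      1 ≤ p → (ν : Measure ℂ) = LaguerreMP.empirical p (α p) := fun p => by
    by_cases hp : 1 ≤ p
    · exact ⟨⟨_, LaguerreMP.isProbabilityMeasure_empirical hp (α p)⟩, fun _ => rfl⟩
    · exact ⟨⟨Measure.dirac 0, inferInstance⟩, fun h => absurd h hp⟩
  choose m hm using hex
  obtain ⟨μ, hμ⟩ : ∃ μ : ProbabilityMeasure ℝ, (μ : Measure ℝ) = LaguerreMP.marchenkoPastur c :=
    ⟨⟨_, LaguerreMP.isProbabilityMeasure_marchenkoPastur hc⟩, rfl⟩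
  refine ⟨m, μ, hm, hμ, ?_⟩
  rw [ProbabilityMeasure.tendsto_iff_forall_integral_tendsto]
  intro f
  rw [ProbabilityMeasure.toMeasure_map, integral_map Complex.measurable_ofReal.aemeasurable
    f.continuous.aestronglyMeasurable, hμ]
  refine (LaguerreMP.tendsto_integral_empirical hc hα hneg f.continuous).congr' ?_
  filter_upwards [eventually_ge_atTop 1] with p hp
  rw [hm p hp]
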